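/- Let $d \ge 2$ be an integer. For a simplicial complex $Y$ let $f_i(Y)$ denote the number of its $i$-dimensional simplices. For $0\le p\le 1$ let $Y_d(n,p)$ be the probability space of all complexes $Y$ on the vertex set $\{1,\dots,n\}$ that contain the full $(d-1)$-dimensional skeleton of the simplex $\Delta_{n-1}$ and are contained in its $d$-dimensional skeleton, with $$\Pr(Y)=p^{f_d(Y)}(1-p)^{\binom{n}{d+1}-f_d(Y)} .$$ A $(d-1)$-dimensional simplex is a free face of a complex $Y$ of dimension at most $d$ if it is contained in a unique $d$-simplex of $Y$. Let $R(Y)$ be the complex obtained from $Y$ by removing all free $(d-1)$-faces together with the $d$-simplices that contain them; let $R_0(Y)=Y$, $R_i(Y)=R(R_{i-1}(Y))$ for $i\ge 1$, and let the $d$-core $R_\infty(Y)=\bigcap_{i\ge 0}R_i(Y)$ be the eventual value of this decreasing sequence. Let $\gamma_d$ be the infimum of the set of all $\gamma\ge 0$ for which the equation $\exp(-\gamma(1-x)^d)-x=0$ has a solution $x<1$. Let $\delta>0$ and $0<c<\gamma_d$ be fixed. Then for $Y\in Y_d(n,\frac{c}{n})$ $$\lim_{n\to\infty}\Pr\left[f_d(R_\infty(Y))>\delta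 n^d\right]=0 .$$ -/

import Mathlib

namespace RandomComplex

open MeasureTheory

/-- The set `K(i)` of `i`-dimensional simplices of a complex: its faces with `i + 1` vertices. -/
def simplices {V : Type*} (K : PreAbstractSimplicialComplex V) (i : ℕ) : Set (Finset V) :=
  {s | s ∈ K.faces ∧ s.card = i + 1}

/-- The number `f_i(K)` of `i`-dimensional simplices of a complex. -/
noncomputable def numSimplices {V : Type*} (K : PreAbstractSimplicialComplex V) (i : ℕ) : ℕ :=
  (simplices K i).ncard

/-- A `(d-1)`-dimensional simplex `τ` (so `τ` has `d` vertices) is a free face of `K` if it is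
contained in a unique `d`-simplex of `K`. -/
def IsFreeFace {V : Type*} (d : ℕ) (K : PreAbstractSimplicialComplex V) (τ : Finset V) : Prop :=
  τ.card = d ∧ ∃! σ, σ ∈ simplices K d ∧ τ ⊆ σ

/-- The `d`-collapse step `R(K)`: remove every free `(d-1)`-face together with the simplices that
contain it. If `dim K ≤ d`, the faces containing a free face `τ` are exactly `τ` itself and the
unique `d`-simplex that contains `τ`. -/
def collapseStep {V : Type*} (d : ℕ) (K : PreAbstractSimplicialComplex V) :
    PreAbstractSimplicialComplex V where
  faces := {s | s ∈ K.faces ∧ ∀ τ, IsFreeFace d K τ → ¬ τ ⊆ s}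
  isRelLowerSet_faces := fun _ hs =>
    ⟨(K.isRelLowerSet_faces hs.1).1, fun _ hts ht =>
      ⟨(K.isRelLowerSet_faces hs.1).2 hts ht, fun τ hτ hτt => hs.2 τ hτ (hτt.trans hts)⟩⟩

/-- The `i`-fold iterate `R_i(K)` of the `d`-collapse step, with `R_0(K) = K`. -/
def collapseIter {V : Type*} (d : ℕ) (K : PreAbstractSimplicialComplex V) :
    ℕ → PreAbstractSimplicialComplex V
  | 0 => K
  | i + 1 => collapseStep d (collapseIter d K i)

/-- The `d`-core `R_∞(K)`: the faces that survive all collapse steps. The complexes `R_i(K)`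
decrease with `i`; if `K` is finite they are eventually constant, with value `R_∞(K)`. -/
def core {V : Type*} (d : ℕ) (K : PreAbstractSimplicialComplex V) :
    PreAbstractSimplicialComplex V where
  faces := {s | ∀ i, s ∈ (collapseIter d K i).faces}
  isRelLowerSet_faces := fun _ hs =>
    ⟨((collapseIter d _ 0).isRelLowerSet_faces (hs 0)).1, fun _ hts ht i =>
      ((collapseIter d _ i).isRelLowerSet_faces (hs i)).2 hts ht⟩

/-- The complexes `Y` on `n` vertices that contain the full `(d-1)`-skeleton of the
`(n-1)`-dimensional simplex (all nonempty vertex sets of size at most `d`) and are contained in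
its `d`-skeleton (all faces have at most `d + 1` vertices). -/
def Complexes (n d : ℕ) : Type :=
  {Y : PreAbstractSimplicialComplex (Fin n) //
    (∀ s : Finset (Fin n), s.Nonempty → s.card ≤ d → s ∈ Y.faces) ∧
    (∀ s ∈ Y.faces, s.card ≤ d + 1)}

/-- All events are measurable. -/
instance (n d : ℕ) : MeasurableSpace (Complexes n d) := ⊤

/-- The random complex `Y_d(n, p)`: the measure under which each `Y` has mass
`p ^ f_d(Y) * (1 - p) ^ (C(n, d+1) - f_d(Y))`. It is a probability measure for `0 ≤ p ≤ 1`. -/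
noncomputable def randomComplex (d n : ℕ) (p : ℝ) : Measure (Complexes n d) :=
  Measure.sum fun Y : Complexes n d =>
    ENNReal.ofReal (p ^ numSimplices Y.1 d * (1 - p) ^ (n.choose (d + 1) - numSimplices Y.1 d)) •
      Measure.dirac Y

/-- The constant `γ_d`: the infimum of all `γ ≥ 0` for which the equation
`exp (-γ (1 - x) ^ d) - x = 0` has a solution `x < 1`. -/
noncomputable def gammaConst (d : ℕ) : ℝ :=
  sInf {γ : ℝ | 0 ≤ γ ∧ ∃ x : ℝ, x < 1 ∧ Real.exp (-γ * (1 - x) ^ d) - x = 0}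

end RandomComplex

namespace RandomComplex

open Finset

/-! ### Random subsets of a finite set -/

/-! The argument is a first moment estimate. A simplex of the core survives every number `k` of
collapse rounds, so by Markov's inequality it is enough to bound the probability that a fixed `σ`
survives `k` rounds, summed over at most `n ^ (d + 1)` choices of `σ`.

Fix a facet `τ` of a survivor `σ`. Some other simplex through `τ` survives `k - 1` rounds, and so do
its neighbours across its other facets. Unless there is a short cycle near `σ`, which has
probability `O(n⁻²)`, this exploration finds a tree of depth `k` made of distinct simplices
(`exists_tree`). The van den Berg-Kesten inequality multiplies the probabilities of disjoint
branches, and Harris' inequality handles the choice of the new vertex. With `p = c / n` this gives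
`p * t_k`, where `t_{k+1} = 1 - (1 - p t_k ^ d) ^ n`.

As `n → ∞`, `t_k` tends to `y_k`, where `y_0 = 1` and `y_{k+1} = 1 - exp (-c y_k ^ d)`. The `y_k`
decrease to a fixed point, and below `γ_d` the only one that is nonnegative is `0`. The bound `(c
y_k + o(1)) / δ` is then small for large `k`. -/

/-- The probability of the event `A` for the random subset of `G` that contains every element
independently with probability `p`. -/
noncomputable def prob {α : Type*} (G : Finset α) (p : ℝ) (A : Finset α → Prop) : ℝ :=
  open Classical in
  ∑ S ∈ G.powerset, if A S then p ^ S.card * (1 - p) ^ (G.card - S.card) else 0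

/-- Two events occur disjointly in `S` if disjoint parts of `S` witness them. -/
def DisjOcc {α : Type*} (A B : Finset α → Prop) (S : Finset α) : Prop :=
  ∃ S₁ S₂, S₁ ⊆ S ∧ S₂ ⊆ S ∧ Disjoint S₁ S₂ ∧ A S₁ ∧ B S₂

section

variable {α : Type*} {G : Finset α} {p : ℝ} {A B : Finset α → Prop}

theorem weight_nonneg (hp : 0 ≤ p) (hp1 : p ≤ 1) (a b : ℕ) : 0 ≤ p ^ a * (1 - p) ^ b :=
  mul_nonneg (pow_nonneg hp _) (pow_nonneg (by linarith) _)

theorem prob_nonneg (hp : 0 ≤ p) (hp1 : p ≤ 1) : 0 ≤ prob G p A := by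
  classical
  refine sum_nonneg fun S _ => ?_
  split_ifs
  exacts [weight_nonneg hp hp1 _ _, le_rfl]

theorem prob_mono (hp : 0 ≤ p) (hp1 : p ≤ 1) (h : ∀ S ⊆ G, A S → B S) :
    prob G p A ≤ prob G p B := by
  classical
  refine sum_le_sum fun S hS => ?_
  have := h S (mem_powerset.1 hS)
  have := weight_nonneg hp hp1 S.card (G.card - S.card)
  split_ifs <;> tauto

theorem prob_congr (h : ∀ S ⊆ G, A S ↔ B S) : prob G p A = prob G p B := by
  classical
  refine sum_congr rfl fun S hS => ?_
  simp only [h S (mem_powerset.1 hS)]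

theorem prob_true : prob G p (fun _ => True) = 1 := by
  classical
  simp only [prob, if_true]
  simpa using sum_pow_mul_eq_add_pow p (1 - p) G

theorem prob_not : prob G p (fun S => ¬ A S) = 1 - prob G p A := by
  classical
  rw [← prob_true (G := G) (p := p), eq_sub_iff_add_eq, prob, prob, prob, ← sum_add_distrib]
  refine sum_congr rfl fun S _ => ?_
  by_cases h : A S <;> simp [h]

theorem prob_le_one (hp : 0 ≤ p) (hp1 : p ≤ 1) : prob G p A ≤ 1 :=
  (prob_mono hp hp1 fun _ _ _ => trivial).trans_eq prob_true

theorem prob_exists_le (hp : 0 ≤ p) (hp1 : p ≤ 1) {ι : Type*} (I : Finset ι)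
    (E : ι → Finset α → Prop) :
    prob G p (fun S => ∃ i ∈ I, E i S) ≤ ∑ i ∈ I, prob G p (E i) := by
  classical
  simp only [prob]
  rw [sum_comm]
  refine sum_le_sum fun S _ => ?_
  have hw := weight_nonneg hp hp1 S.card (G.card - S.card)
  have hnn : ∀ i ∈ I, (0 : ℝ) ≤ if E i S then p ^ S.card * (1 - p) ^ (G.card - S.card) else 0 :=
    fun i _ => by split_ifs <;> simp [hw]
  split_ifs with h
  · obtain ⟨i, hi, hE⟩ := h
    exact (by simp [hE] : p ^ S.card * (1 - p) ^ (G.card - S.card) ≤ _).trans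
      (single_le_sum hnn hi)
  · exact sum_nonneg hnn

theorem prob_or_le (hp : 0 ≤ p) (hp1 : p ≤ 1) :
    prob G p (fun S => A S ∨ B S) ≤ prob G p A + prob G p B := by
  classical
  simp only [prob]
  rw [← sum_add_distrib]
  refine sum_le_sum fun S _ => ?_
  have hw := weight_nonneg hp hp1 S.card (G.card - S.card)
  split_ifs <;> first | linarith | tauto

/-- Inclusion-exclusion bound for an event contained in a union. -/
theorem prob_add_le_add (hp : 0 ≤ p) (hp1 : p ≤ 1) {C D : Finset α → Prop}
    (hU : ∀ S ⊆ G, C S → A S ∨ B S) (hI : ∀ S ⊆ G, D S → A S ∧ B S) :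
    prob G p C + prob G p D ≤ prob G p A + prob G p B := by
  classical
  simp only [prob]
  rw [← sum_add_distrib, ← sum_add_distrib]
  refine sum_le_sum fun S hS => ?_
  have hw := weight_nonneg hp hp1 S.card (G.card - S.card)
  have h1 := hU S (mem_powerset.1 hS)
  have h2 := hI S (mem_powerset.1 hS)
  split_ifs <;> first | linarith | tauto

/-- Markov's inequality for the number of occurring events. -/
theorem mul_prob_le_sum (hp : 0 ≤ p) (hp1 : p ≤ 1) {ι : Type*} (I : Finset ι)
    (E : ι → Finset α → Prop) [∀ i S, Decidable (E i S)] (r : ℝ) :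
    r * prob G p (fun S => r < ((I.filter fun i => E i S).card : ℝ)) ≤
      ∑ i ∈ I, prob G p (E i) := by
  classical
  simp only [prob]
  rw [sum_comm, mul_sum]
  refine sum_le_sum fun S _ => ?_
  have hw := weight_nonneg hp hp1 S.card (G.card - S.card)
  have e : ∑ i ∈ I, (@ite ℝ (E i S) (Classical.propDecidable _)
      (p ^ S.card * (1 - p) ^ (G.card - S.card)) 0) =
      ((I.filter fun i => E i S).card : ℝ) * (p ^ S.card * (1 - p) ^ (G.card - S.card)) := by
    rw [← nsmul_eq_mul, ← sum_const, sum_filter]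
    exact sum_congr rfl fun i _ => by congr
  rw [e]
  split_ifs with h
  · exact mul_le_mul_of_nonneg_right h.le hw
  · rw [mul_zero]; positivity

theorem prob_empty : prob ∅ p A = open Classical in if A ∅ then 1 else 0 := by
  classical
  simp [prob]

theorem DisjOcc.monotone : Monotone (DisjOcc A B) :=
  fun _ _ h ⟨S₁, S₂, h1, h2, h3⟩ => ⟨S₁, S₂, h1.trans h, h2.trans h, h3⟩

/-- The events `E i`, `i ∈ I`, occur in `S` with pairwise disjoint witnesses. -/
def DisjOccOn {ι : Type*} (I : Finset ι) (E : ι → Finset α → Prop) (S : Finset α) : Prop :=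
  ∃ F : ι → Finset α, (∀ i ∈ I, F i ⊆ S) ∧ (I : Set ι).PairwiseDisjoint F ∧ ∀ i ∈ I, E i (F i)

theorem DisjOccOn.monotone {ι : Type*} (I : Finset ι) (E : ι → Finset α → Prop) :
    Monotone (DisjOccOn I E) :=
  fun _ _ h ⟨F, h1, h2⟩ => ⟨F, fun i hi => (h1 i hi).trans h, h2⟩

variable [DecidableEq α]

theorem prob_insert {a : α} (ha : a ∉ G) :
    prob (insert a G) p A = (1 - p) * prob G p A + p * prob G p (fun S => A (insert a S)) := by
  classical
  simp only [prob]
  rw [sum_powerset_insert ha, mul_sum, mul_sum]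
  congr 1
  · refine sum_congr rfl fun S hS => ?_
    have h1 := card_le_card (mem_powerset.1 hS)
    rw [card_insert_of_notMem ha, Nat.succ_sub h1, pow_succ]
    split_ifs <;> ring
  · refine sum_congr rfl fun S hS => ?_
    have : a ∉ S := fun h => ha (mem_powerset.1 hS h)
    rw [card_insert_of_notMem ha, card_insert_of_notMem this, Nat.add_sub_add_right, pow_succ]
    split_ifs <;> ring

theorem Monotone.comp_insert (hA : Monotone A) (a : α) : Monotone fun S => A (insert a S) :=
  fun _ _ h => hA (insert_subset_insert a h)

/-- Harris' inequality for decreasing events. -/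
theorem prob_and_ge_of_antitone (hp : 0 ≤ p) (hp1 : p ≤ 1) (hA : Antitone A) (hB : Antitone B) :
    prob G p A * prob G p B ≤ prob G p (fun S => A S ∧ B S) := by
  induction G using Finset.induction_on generalizing A B with
  | empty =>
    simp only [prob_empty]
    split_ifs <;> first | (norm_num; done) | tauto
  | insert a G ha ih =>
    rw [prob_insert ha, prob_insert ha, prob_insert ha]
    have hA' : Antitone fun S => A (insert a S) := fun _ _ h => hA (insert_subset_insert a h)
    have hB' : Antitone fun S => B (insert a S) := fun _ _ h => hB (insert_subset_insert a h)
    have h0 := ih hA hB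
    have h1 := ih hA' hB'
    have ka : prob G p (fun S => A (insert a S)) ≤ prob G p A :=
      prob_mono hp hp1 fun S _ => hA (subset_insert a S)
    have kb : prob G p (fun S => B (insert a S)) ≤ prob G p B :=
      prob_mono hp hp1 fun S _ => hB (subset_insert a S)
    have hq : 0 ≤ 1 - p := by linarith
    -- The gap left after the induction hypotheses is exactly this covariance term in the coordinate
    -- `a`.
    have k := mul_nonneg (mul_nonneg hp hq) (mul_nonneg (sub_nonneg.2 ka) (sub_nonneg.2 kb))
    have e0 := mul_le_mul_of_nonneg_left h0 hq
    have e1 := mul_le_mul_of_nonneg_left h1 hp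
    nlinarith

theorem prod_prob_le_of_antitone (hp : 0 ≤ p) (hp1 : p ≤ 1) {ι : Type*} (I : Finset ι)
    {E : ι → Finset α → Prop} (hE : ∀ i ∈ I, Antitone (E i)) :
    ∏ i ∈ I, prob G p (E i) ≤ prob G p (fun S => ∀ i ∈ I, E i S) := by
  classical
  induction I using Finset.induction_on with
  | empty => simp [prob_true]
  | insert i I hi ih =>
    rw [prod_insert hi]
    have h1 := ih fun j hj => hE j (mem_insert_of_mem hj)
    have h2 : Antitone fun S => ∀ i ∈ I, E i S :=
      fun S T h hT j hj => hE j (mem_insert_of_mem hj) h (hT j hj)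
    refine (mul_le_mul_of_nonneg_left h1 (prob_nonneg hp hp1)).trans ?_
    refine (prob_and_ge_of_antitone hp hp1 (hE i (mem_insert_self _ _)) h2).trans_eq ?_
    exact prob_congr fun S _ => by simp

/-- The complements are decreasing, hence positively correlated. A union bound would lead to the
recursion `y ↦ c y ^ d`, which does not tend to `0` from `1` when `c ≥ 1`. -/
theorem prob_exists_le_of_monotone (hp : 0 ≤ p) (hp1 : p ≤ 1) {ι : Type*} (I : Finset ι)
    {E : ι → Finset α → Prop} (hE : ∀ i ∈ I, Monotone (E i)) :
    prob G p (fun S => ∃ i ∈ I, E i S) ≤ 1 - ∏ i ∈ I, (1 - prob G p (E i)) := by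
  have h := prod_prob_le_of_antitone (G := G) hp hp1 I (E := fun i S => ¬ E i S)
    fun i hi S T hST hT hS => hT (hE i hi hST hS)
  have e : prob G p (fun S => ∀ i ∈ I, ¬ E i S) = 1 - prob G p (fun S => ∃ i ∈ I, E i S) := by
    rw [← prob_not]; exact prob_congr fun S _ => by simp
  rw [e] at h
  simp only [prob_not] at h
  linarith

/-- The van den Berg-Kesten inequality for increasing events, for `p ≤ 1/2`. -/
theorem prob_disjOcc_le (hp : 0 ≤ p) (hp1 : p ≤ 1 / 2) (hA : Monotone A) (hB : Monotone B) :
    prob G p (DisjOcc A B) ≤ prob G p A * prob G p B := by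
  have hp' : p ≤ 1 := by linarith
  induction G using Finset.induction_on generalizing A B with
  | empty =>
    have : DisjOcc A B ∅ → A ∅ ∧ B ∅ := by
      rintro ⟨S₁, S₂, h1, h2, -, h⟩
      rwa [subset_empty.1 h1, subset_empty.1 h2] at h
    simp only [prob_empty]
    split_ifs <;> first | (norm_num; done) | tauto
  | insert a G ha ih =>
    rw [prob_insert ha, prob_insert ha, prob_insert ha]
    have hA' := Monotone.comp_insert hA a
    have hB' := Monotone.comp_insert hB a
    have h00 := ih hA hB
    have h10 := ih hA' hB
    have h01 := ih hA hB'
    have ka : prob G p A ≤ prob G p (fun S => A (insert a S)) :=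
      prob_mono hp hp' fun S _ => hA (subset_insert a S)
    have kb : prob G p B ≤ prob G p (fun S => B (insert a S)) :=
      prob_mono hp hp' fun S _ => hB (subset_insert a S)
    -- When `a` is present, at most one of the two disjoint witnesses uses it. This gives the union;
    -- a disjoint occurrence without `a` lies in the intersection.
    have key : prob G p (fun S => DisjOcc A B (insert a S)) + prob G p (DisjOcc A B) ≤
        prob G p (DisjOcc (fun S => A (insert a S)) B) +
          prob G p (DisjOcc A (fun S => B (insert a S))) := by
      refine prob_add_le_add hp hp' ?_ ?_
      · rintro S - ⟨S₁, S₂, h1, h2, h3, h4, h5⟩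
        by_cases h : a ∈ S₁
        · have h' : a ∉ S₂ := disjoint_left.1 h3 h
          exact .inl ⟨S₁.erase a, S₂, subset_insert_iff.1 h1,
            (subset_insert_iff_of_notMem h').1 h2,
            disjoint_of_subset_left (erase_subset _ _) h3, by simpa only [insert_erase h] using h4, h5⟩
        · exact .inr ⟨S₁, S₂.erase a, (subset_insert_iff_of_notMem h).1 h1,
            subset_insert_iff.1 h2, disjoint_of_subset_right (erase_subset _ _) h3, h4,
            hB (insert_erase_subset a S₂) h5⟩
      · rintro S - ⟨S₁, S₂, h1, h2, h3, h4, h5⟩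
        exact ⟨⟨S₁, S₂, h1, h2, h3, hA (subset_insert a _) h4, h5⟩,
          ⟨S₁, S₂, h1, h2, h3, h4, hB (subset_insert a _) h5⟩⟩
    have k := mul_nonneg (mul_nonneg hp hp) (mul_nonneg (sub_nonneg.2 ka) (sub_nonneg.2 kb))
    -- Using `key` lowers the coefficient of the term without `a` from `1 - p` to `1 - 2 * p`; the
    -- induction hypothesis applies to it only if this is nonnegative, whence `p ≤ 1 / 2`.
    have e0 := mul_le_mul_of_nonneg_left h00 (by linarith : 0 ≤ 1 - 2 * p)
    have e1 := mul_le_mul_of_nonneg_left h10 hp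
    have e2 := mul_le_mul_of_nonneg_left h01 hp
    have e3 := mul_le_mul_of_nonneg_left key hp
    nlinarith

theorem prob_disjOccOn_le (hp : 0 ≤ p) (hp1 : p ≤ 1 / 2) {ι : Type*} (I : Finset ι)
    {E : ι → Finset α → Prop} (hE : ∀ i ∈ I, Monotone (E i)) :
    prob G p (DisjOccOn I E) ≤ ∏ i ∈ I, prob G p (E i) := by
  classical
  have hp' : p ≤ 1 := by linarith
  induction I using Finset.induction_on with
  | empty => simpa using prob_le_one hp hp'
  | insert i I hi ih =>
    rw [prod_insert hi]
    refine le_trans ?_ (mul_le_mul_of_nonneg_left (ih fun j hj => hE j (mem_insert_of_mem hj))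
      (prob_nonneg hp hp'))
    refine le_trans ?_ (prob_disjOcc_le hp hp1 (hE i (mem_insert_self _ _))
      (DisjOccOn.monotone I E))
    refine prob_mono hp hp' ?_
    rintro S - ⟨F, h1, h2, h3⟩
    refine ⟨F i, I.biUnion F, h1 i (mem_insert_self _ _), biUnion_subset.2 fun j hj =>
      h1 j (mem_insert_of_mem hj), ?_, h3 i (mem_insert_self _ _), F,
      fun j hj => subset_biUnion_of_mem F hj, h2.subset (by simp),
      fun j hj => h3 j (mem_insert_of_mem hj)⟩
    rw [disjoint_biUnion_right]
    intro j hj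
    exact h2 (by simp) (by simp [hj]) fun h => hi (h ▸ hj)

theorem prob_subset_le (hp : 0 ≤ p) (hp1 : p ≤ 1) (T : Finset α) :
    prob G p (fun S => T ⊆ S) ≤ p ^ T.card := by
  induction G using Finset.induction_on generalizing T with
  | empty =>
    rw [prob_empty]
    split_ifs with h
    · simp [subset_empty.1 h]
    · positivity
  | insert a G ha ih =>
    rw [prob_insert ha]
    by_cases haT : a ∈ T
    · have h0 : prob G p (fun S => T ⊆ S) ≤ 0 := by
        refine (prob_mono hp hp1 (B := fun _ => ¬ True) fun S hS h => ?_).trans_eq ?_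
        · exact absurd (hS (h haT)) ha
        · rw [prob_not, prob_true, sub_self]
      have h1 : prob G p (fun S => T ⊆ insert a S) ≤ p ^ (T.erase a).card := by
        refine (prob_mono hp hp1 fun S _ h => ?_).trans (ih (T.erase a))
        exact subset_insert_iff.1 h
      rw [← card_erase_add_one haT, pow_succ]
      nlinarith [mul_le_mul_of_nonneg_left h1 hp,
        mul_le_mul_of_nonneg_left h0 (sub_nonneg.2 hp1)]
    · have h1 : prob G p (fun S => T ⊆ insert a S) = prob G p (fun S => T ⊆ S) :=
        prob_congr fun S _ => subset_insert_iff_of_notMem haT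
      rw [h1]
      linarith [ih T]

theorem prob_mem_le (hp : 0 ≤ p) (hp1 : p ≤ 1) (a : α) : prob G p (fun S => a ∈ S) ≤ p := by
  simpa using prob_subset_le (G := G) hp hp1 {a}

end

/-! ### Disjoint witness trees -/

section

variable {V : Type*}

/-- The simplex `s` of the family `S` survives `k` steps of the `d`-collapse. -/
def Survives (d : ℕ) (S : Finset (Finset V)) : ℕ → Finset V → Prop
  | 0, s => s ∈ S
  | k + 1, s => Survives d S k s ∧
      ∀ τ ⊆ s, τ.card = d → ∃ s', s' ≠ s ∧ Survives d S k s' ∧ τ ⊆ s'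

theorem Survives.mem {d : ℕ} {S : Finset (Finset V)} {k : ℕ} {s : Finset V}
    (h : Survives d S k s) : s ∈ S := by
  induction k with
  | zero => exact h
  | succ k ih => exact ih h.1

variable [DecidableEq V]

/-- The family `S` of simplices contains a tree of depth `k` growing from the face `τ`: there is a
simplex through `τ` such that from its other facets there grow disjoint trees of depth `k - 1`. -/
def HasTree : ℕ → Finset V → Finset (Finset V) → Prop
  | 0, _, _ => True
  | k + 1, τ, S => ∃ v, v ∉ τ ∧
      DisjOcc (fun S => insert v τ ∈ S) (DisjOccOn τ fun w => HasTree k ((insert v τ).erase w)) S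

theorem HasTree.monotone (k : ℕ) (τ : Finset V) : Monotone (HasTree k τ) := by
  cases k with
  | zero => exact fun _ _ _ _ => trivial
  | succ k => exact fun _ _ h ⟨v, hv, hS⟩ => ⟨v, hv, DisjOcc.monotone h hS⟩

/-- The upper bound for the probability of a tree of depth `k`, for `n` vertices. -/
noncomputable def treeBound (d n : ℕ) (p : ℝ) : ℕ → ℝ
  | 0 => 1
  | k + 1 => 1 - (1 - p * treeBound d n p k ^ d) ^ n

theorem treeBound_mem_Icc (d n : ℕ) {p : ℝ} (hp : 0 ≤ p) (hp1 : p ≤ 1) (k : ℕ) :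
    treeBound d n p k ∈ Set.Icc 0 1 := by
  induction k with
  | zero => simp [treeBound]
  | succ k ih =>
    have h0 : 0 ≤ p * treeBound d n p k ^ d := mul_nonneg hp (pow_nonneg ih.1 _)
    have h1 : p * treeBound d n p k ^ d ≤ 1 :=
      mul_le_one₀ hp1 (pow_nonneg ih.1 _) (pow_le_one₀ ih.1 ih.2)
    have h2 : 0 ≤ (1 - p * treeBound d n p k ^ d) ^ n := pow_nonneg (by linarith) _
    have h3 : (1 - p * treeBound d n p k ^ d) ^ n ≤ 1 := pow_le_one₀ (by linarith) (by linarith)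
    exact ⟨by simp only [treeBound]; linarith, by simp only [treeBound]; linarith⟩

/-- For a fixed apex `v`, van den Berg-Kesten gives a factor `p` for the simplex and one factor `q`
for each of its `d` other facets. Harris combines the at most `n` choices of `v`. -/
theorem prob_hasTree_le [Fintype V] (G : Finset (Finset V)) {p : ℝ} (hp : 0 ≤ p)
    (hp1 : p ≤ 1 / 2) {d : ℕ} (k : ℕ) {τ : Finset V} (hτ : τ.card = d) :
    prob G p (HasTree k τ) ≤ treeBound d (Fintype.card V) p k := by
  have hp' : p ≤ 1 := by linarith
  induction k generalizing τ with
  | zero => exact prob_le_one hp hp'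
  | succ k ih =>
    set q := treeBound d (Fintype.card V) p k with hq
    have hqm := treeBound_mem_Icc d (Fintype.card V) hp hp' k
    have h0 : 0 ≤ p * q ^ d := mul_nonneg hp (pow_nonneg hqm.1 _)
    have h1 : p * q ^ d ≤ 1 := mul_le_one₀ hp' (pow_nonneg hqm.1 _) (pow_le_one₀ hqm.1 hqm.2)
    have key : ∀ v ∈ τᶜ, prob G p (DisjOcc (fun S => insert v τ ∈ S)
        (DisjOccOn τ fun w => HasTree k ((insert v τ).erase w))) ≤ p * q ^ d := by
      intro v hv
      have hv : v ∉ τ := by simpa using hv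
      refine (prob_disjOcc_le hp hp1 (fun _ _ h hS => h hS) (DisjOccOn.monotone _ _)).trans ?_
      refine mul_le_mul (prob_mem_le hp hp' _) ?_ (prob_nonneg hp hp') hp
      refine (prob_disjOccOn_le hp hp1 τ fun w _ => HasTree.monotone _ _).trans ?_
      rw [← hτ, ← prod_const]
      refine prod_le_prod (fun _ _ => prob_nonneg hp hp') fun w hw => ih ?_
      rw [card_erase_of_mem (mem_insert_of_mem hw), card_insert_of_notMem hv, hτ,
        Nat.add_sub_cancel]
    have e := prob_exists_le_of_monotone (G := G) hp hp' τᶜ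
      (E := fun v => DisjOcc (fun S => insert v τ ∈ S)
        (DisjOccOn τ fun w => HasTree k ((insert v τ).erase w))) fun _ _ => DisjOcc.monotone
    refine (prob_mono hp hp' ?_).trans (e.trans ?_)
    · rintro S - ⟨v, hv, h⟩
      exact ⟨v, by simpa using hv, h⟩
    · simp only [treeBound, ← hq]
      refine sub_le_sub_left ?_ _
      calc (1 - p * q ^ d) ^ Fintype.card V ≤ (1 - p * q ^ d) ^ (τᶜ).card :=
            pow_le_pow_of_le_one (by linarith) (by linarith) (card_le_univ _)
        _ = ∏ v ∈ τᶜ, (1 - p * q ^ d) := (prod_const _).symm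
        _ ≤ _ := prod_le_prod (fun _ _ => by linarith) fun v hv => by linarith [key v hv]

/-- The number of simplices of a tree of depth `k`. -/
def treeSize (d : ℕ) : ℕ → ℕ
  | 0 => 0
  | k + 1 => d * treeSize d k + 1

/-- Every subfamily of `S` that contains `σ` and has at most `N` members has as many vertices as
a family grown from `σ` by adding simplices with a new vertex. -/
def LocallyTreelike (d N : ℕ) (σ : Finset V) (S : Finset (Finset V)) : Prop :=
  ∀ T ⊆ S, σ ∈ T → T.card ≤ N → d + T.card ≤ (T.biUnion id).card

/-- A locally treelike subfamily can be extended by a tree growing from a face `τ` that lies in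
only one of its members, if this member survives. -/
theorem exists_tree {d N : ℕ} {σ : Finset V} {S : Finset (Finset V)}
    (hS : ∀ s ∈ S, s.card = d + 1) (hg : LocallyTreelike d N σ S) (k : ℕ) {s τ : Finset V}
    (hs : Survives d S k s) (hτs : τ ⊆ s) (hτ : τ.card = d) {T : Finset (Finset V)} (hT : T ⊆ S)
    (hσ : σ ∈ T) (hTc : (T.biUnion id).card ≤ d + T.card) (hN : T.card + treeSize d k ≤ N)
    (hsT : s ∈ T) (huniq : ∀ s' ∈ T, τ ⊆ s' → s' = s) :
    ∃ F ⊆ S, Disjoint F T ∧ HasTree k τ F ∧ F.card ≤ treeSize d k ∧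
      ((T ∪ F).biUnion id).card ≤ d + (T ∪ F).card ∧
      ∀ s' ∈ F, ∀ ρ ⊆ s', ρ.card = d → ρ ⊆ T.biUnion id → ρ = τ := by
  induction k generalizing s τ T with
  | zero => exact ⟨∅, by simp, by simp, trivial, by simp, by simpa using hTc, by simp⟩
  | succ k ih =>
    obtain ⟨s', hne, hs', hτs'⟩ := hs.2 τ hτs hτ
    have hs'S := hs'.mem
    have hs'T : s' ∉ T := fun h => hne (huniq s' h hτs')
    obtain ⟨v, hvτ, rfl⟩ : ∃ v, v ∉ τ ∧ insert v τ = s' := by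
      have h1 : (s' \ τ).card = 1 := by rw [card_sdiff_of_subset hτs', hS s' hs'S, hτ]; omega
      obtain ⟨v, hv⟩ := card_eq_one.1 h1
      refine ⟨v, fun h => ?_, ?_⟩
      · have : v ∈ s' \ τ := by simp [hv]
        exact (mem_sdiff.1 this).2 h
      · rw [insert_eq, ← hv, sdiff_union_of_subset hτs']
    have hτT : τ ⊆ T.biUnion id := fun x hx => mem_biUnion.2 ⟨s, hsT, hτs hx⟩
    set s' := insert v τ with hs'def
    set T₁ := insert s' T with hT₁
    have hT₁S : T₁ ⊆ S := insert_subset hs'S hT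
    have hT₁c : T₁.card = T.card + 1 := card_insert_of_notMem hs'T
    have hverts : T₁.biUnion id = insert v (T.biUnion id) := by
      rw [hT₁, biUnion_insert, id, hs'def, insert_union, union_eq_right.2 hτT]
    -- If `v` were an old vertex, `T₁` would have one more simplex than `T` but no more vertices,
    -- against local treelikeness.
    have hvT : v ∉ T.biUnion id := by
      intro hv
      have := hg T₁ hT₁S (mem_insert_of_mem hσ) (by rw [hT₁c]; simp only [treeSize] at hN; omega)
      rw [hverts, insert_eq_of_mem hv] at this
      omega
    have hT₁v : (T₁.biUnion id).card ≤ d + T₁.card := by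
      rw [hverts, card_insert_of_notMem hvT, hT₁c]; omega
    -- The subtrees are grown one facet at a time, each avoiding everything found so far.
    have main : ∀ W ⊆ τ, ∃ F : V → Finset (Finset V), (∀ w ∈ W, F w ⊆ S) ∧
        (∀ w ∈ W, Disjoint (F w) T₁) ∧ (W : Set V).PairwiseDisjoint F ∧
        (∀ w ∈ W, HasTree k (s'.erase w) (F w)) ∧
        (W.biUnion F).card ≤ W.card * treeSize d k ∧
        ((T₁ ∪ W.biUnion F).biUnion id).card ≤ d + (T₁ ∪ W.biUnion F).card ∧
        ∀ w ∈ W, ∀ t ∈ F w, ∀ ρ ⊆ t, ρ.card = d → ρ ⊆ T₁.biUnion id → ρ = s'.erase w := by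
      intro W
      induction W using Finset.induction_on with
      | empty => exact fun _ => ⟨fun _ => ∅, by simp, by simp, by simp, by simp, by simp,
          by simpa using hT₁v, by simp⟩
      | insert w W hw ihW =>
        intro hWτ
        obtain ⟨F, hFS, hFT, hFd, hFw, hFc, hFv, hFρ⟩ := ihW ((subset_insert _ _).trans hWτ)
        have hwτ : w ∈ τ := hWτ (mem_insert_self _ _)
        have hwv : v ≠ w := fun h => hvτ (h ▸ hwτ)
        have hce : (s'.erase w).card = d := by
          rw [card_erase_of_mem (mem_insert_of_mem hwτ), card_insert_of_notMem hvτ, hτ,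
            Nat.add_sub_cancel]
        have hvs : v ∈ s'.erase w := mem_erase.2 ⟨hwv, mem_insert_self _ _⟩
        have hsT₁ : s'.erase w ⊆ T₁.biUnion id := fun x hx =>
          mem_biUnion.2 ⟨s', mem_insert_self _ _, mem_of_mem_erase hx⟩
        have hWd : (insert w W).card ≤ d := hτ ▸ card_le_card hWτ
        rw [card_insert_of_notMem hw] at hWd
        have hcard : (T₁ ∪ W.biUnion F).card + treeSize d k ≤ N := by
          have h1 := card_union_le T₁ (W.biUnion F)
          have h2 : (W.card + 1) * treeSize d k ≤ d * treeSize d k := Nat.mul_le_mul_right _ hWd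
          rw [add_mul, one_mul] at h2
          simp only [treeSize] at hN
          omega
        -- The facet opposite `w` lies in no found simplex but `s'`: it contains the new vertex `v`,
        -- so it is in no member of `T`, and an earlier subtree meets the old vertices in a full
        -- facet only at its own root.
        obtain ⟨F', hF'S, hF'T, hF', hF'c, hF'v, hF'ρ⟩ := ih (s := s') (τ := s'.erase w) hs'
          (erase_subset _ _) hce (T := T₁ ∪ W.biUnion F)
          (union_subset hT₁S (biUnion_subset.2 hFS)) (mem_union_left _ (mem_insert_of_mem hσ))
          hFv hcard (mem_union_left _ (mem_insert_self _ _)) (by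
            intro t ht hst
            rcases mem_union.1 ht with ht | ht
            · rcases mem_insert.1 ht with rfl | ht
              · rfl
              · exact absurd (mem_biUnion.2 ⟨t, ht, hst hvs⟩) hvT
            · obtain ⟨w', hw', ht⟩ := mem_biUnion.1 ht
              have := hFρ w' hw' t ht _ hst hce hsT₁
              have h3 : w ∈ s'.erase w' :=
                mem_erase.2 ⟨fun h : w = w' => hw (h ▸ hw'), mem_insert_of_mem hwτ⟩
              rw [← this] at h3
              exact absurd h3 (notMem_erase _ _))
        have hup : ∀ x ∈ W, Function.update F w F' x = F x := fun x hx =>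
          Function.update_of_ne (fun h : x = w => hw (h ▸ hx)) _ _
        have hbU : W.biUnion (Function.update F w F') = W.biUnion F := biUnion_congr rfl hup
        rw [disjoint_union_right] at hF'T
        refine ⟨Function.update F w F', ?_, ?_, ?_, ?_, ?_, ?_, ?_⟩
        · rw [forall_mem_insert, Function.update_self]
          exact ⟨hF'S, fun x hx => by rw [hup x hx]; exact hFS x hx⟩
        · rw [forall_mem_insert, Function.update_self]
          exact ⟨hF'T.1, fun x hx => by rw [hup x hx]; exact hFT x hx⟩
        · rw [coe_insert, Set.pairwiseDisjoint_insert_of_notMem (by simpa using hw)]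
          refine ⟨fun x hx y hy hxy => ?_, fun x hx => ?_⟩
          · rw [Function.onFun, hup x hx, hup y hy]; exact hFd hx hy hxy
          · rw [Function.update_self, hup x hx]
            exact disjoint_of_subset_right (subset_biUnion_of_mem F hx) hF'T.2
        · rw [forall_mem_insert, Function.update_self]
          exact ⟨hF', fun x hx => by rw [hup x hx]; exact hFw x hx⟩
        · rw [biUnion_insert, Function.update_self, hbU, card_insert_of_notMem hw, add_mul,
            one_mul]
          have := card_union_le F' (W.biUnion F)
          omega
        · rw [biUnion_insert, Function.update_self, hbU, union_comm F', ← union_assoc]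
          exact hF'v
        · rw [forall_mem_insert, Function.update_self]
          refine ⟨fun t ht ρ hρ hc hρT => hF'ρ t ht ρ hρ hc (hρT.trans ?_), fun x hx => ?_⟩
          · exact biUnion_subset_biUnion_of_subset_left _ subset_union_left
          · rw [hup x hx]; exact hFρ x hx
    obtain ⟨F, hFS, hFT, hFd, hFw, hFc, hFv, hFρ⟩ := main τ subset_rfl
    have hF1 : Disjoint (τ.biUnion F) T₁ := disjoint_biUnion_left _ _ _ |>.2 hFT
    have hF2 : s' ∉ τ.biUnion F := fun h => disjoint_left.1 hF1 h (mem_insert_self _ _)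
    refine ⟨insert s' (τ.biUnion F), insert_subset hs'S (biUnion_subset.2 hFS), ?_, ?_, ?_, ?_, ?_⟩
    · rw [disjoint_insert_left]
      exact ⟨hs'T, disjoint_of_subset_right (subset_insert _ _) hF1⟩
    · refine ⟨v, hvτ, {s'}, τ.biUnion F, by simp, subset_insert _ _, by simpa using hF2,
        mem_singleton_self _, F, fun w hw => subset_biUnion_of_mem F hw, hFd, hFw⟩
    · rw [card_insert_of_notMem hF2, treeSize]
      rw [hτ] at hFc
      omega
    · rw [union_insert, ← insert_union]
      exact hFv
    · rw [forall_mem_insert]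
      -- A face on old vertices omits `v`. In `s'` this leaves only `τ`; in a subtree it would be a
      -- facet of `s'` containing `v`.
      have key : ∀ ρ : Finset V, ρ ⊆ T.biUnion id → v ∉ ρ := fun ρ h hv => hvT (h hv)
      refine ⟨fun ρ hρ hc hρT => ?_, fun t ht ρ hρ hc hρT => ?_⟩
      · refine eq_of_subset_of_card_le ?_ (by rw [hc, hτ])
        exact (subset_insert_iff_of_notMem (key ρ hρT)).1 hρ
      · obtain ⟨w, hw, ht⟩ := mem_biUnion.1 ht
        have := hFρ w hw t ht ρ hρ hc
          (hρT.trans (biUnion_subset_biUnion_of_subset_left _ (subset_insert _ _)))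
        refine absurd ?_ (key ρ hρT)
        rw [this]
        exact mem_erase.2 ⟨fun h => hvτ (h ▸ hw), mem_insert_self _ _⟩

theorem Survives.disjOcc {d k : ℕ} {σ τ : Finset V} {S : Finset (Finset V)}
    (hS : ∀ s ∈ S, s.card = d + 1) (hg : LocallyTreelike d (treeSize d k + 1) σ S)
    (hσ : Survives d S k σ) (hτσ : τ ⊆ σ) (hτ : τ.card = d) :
    DisjOcc (fun S => σ ∈ S) (HasTree k τ) S := by
  obtain ⟨F, hFS, hF, hFt, -⟩ := exists_tree hS hg k hσ hτσ hτ (T := {σ})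
    (by simpa using hσ.mem) (by simp) (by simp [hS σ hσ.mem]) (by simp [add_comm]) (by simp)
    (by simp)
  exact ⟨{σ}, F, by simpa using hσ.mem, hFS, hF.symm, mem_singleton_self _, hFt⟩

end

/-! ### Short cycles are rare -/

/-- A violating family of `j + 2` simplices has at most `j` vertices outside `σ`. There are at most
`n ^ j` ways to place these, against a probability `p ^ (j + 2)`, so two factors `1 / n` are gained
when `p = c / n`. -/
theorem prob_not_locallyTreelike_le {V : Type*} [DecidableEq V] [Fintype V]
    (G : Finset (Finset V)) {p : ℝ} (hp : 0 ≤ p) (hp1 : p ≤ 1) {d N : ℕ} {σ : Finset V}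
    (hσ : σ.card = d + 1) (hN : N ≤ Fintype.card V) :
    prob G p (fun S => ¬ LocallyTreelike d N σ S) ≤
      ∑ j ∈ range N, (Fintype.card V : ℝ) ^ j * (2 ^ 2 ^ (d + 1 + N) * p ^ (j + 2)) := by
  have hsub : ∀ S ⊆ G, ¬ LocallyTreelike d N σ S → ∃ j ∈ range N,
      ∃ U ∈ powersetCard j (univ : Finset V),
        ∃ T ∈ {T ∈ (σ ∪ U).powerset.powerset | T.card = j + 2}, T ⊆ S := by
    intro S _ h
    simp only [LocallyTreelike, not_forall, not_le] at h
    obtain ⟨T, hTS, hσT, hTN, hlt⟩ := h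
    have h1 : σ ⊆ T.biUnion id := subset_biUnion_of_mem id hσT
    have h2 := card_le_card h1
    have h3 := card_sdiff_of_subset h1
    -- The outside vertices are padded to exactly `T.card - 2`; `N ≤ n` leaves room for this.
    obtain ⟨U, hU, -, hUc⟩ := exists_subsuperset_card_eq (subset_univ (T.biUnion id \ σ))
      (n := T.card - 2) (by omega) (by rw [card_univ]; omega)
    refine ⟨T.card - 2, mem_range.2 (by omega), U, by simp [hUc], T, ?_, hTS⟩
    rw [mem_filter, mem_powerset]
    refine ⟨fun t ht => mem_powerset.2 fun x hx => ?_, by omega⟩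
    by_cases hxσ : x ∈ σ
    · exact mem_union_left _ hxσ
    · exact mem_union_right _ (hU (mem_sdiff.2 ⟨mem_biUnion.2 ⟨t, ht, hx⟩, hxσ⟩))
  refine (prob_mono hp hp1 hsub).trans ((prob_exists_le hp hp1 _ _).trans ?_)
  refine sum_le_sum fun j hj => (prob_exists_le hp hp1 _ _).trans ?_
  have hU : ((powersetCard j (univ : Finset V)).card : ℝ) ≤ (Fintype.card V : ℝ) ^ j := by
    rw [card_powersetCard, card_univ]
    exact_mod_cast Nat.choose_le_pow _ _
  have hK : (0 : ℝ) ≤ 2 ^ 2 ^ (d + 1 + N) * p ^ (j + 2) := by positivity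
  refine le_trans ?_ (mul_le_mul_of_nonneg_right hU hK)
  rw [← nsmul_eq_mul]
  refine sum_le_card_nsmul _ _ _ fun U hUj => (prob_exists_le hp hp1 _ _).trans ?_
  have hT : (({T ∈ (σ ∪ U).powerset.powerset | T.card = j + 2}.card : ℕ) : ℝ) ≤
      2 ^ 2 ^ (d + 1 + N) := by
    have h1 : (σ ∪ U).card ≤ d + 1 + N := by
      have := card_union_le σ U
      have := (mem_powersetCard.1 hUj).2
      have := mem_range.1 hj
      omega
    have h2 := card_filter_le (σ ∪ U).powerset.powerset fun T => T.card = j + 2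
    rw [card_powerset, card_powerset] at h2
    have h3 : 2 ^ 2 ^ (σ ∪ U).card ≤ 2 ^ 2 ^ (d + 1 + N) :=
      Nat.pow_le_pow_right (by norm_num) (Nat.pow_le_pow_right (by norm_num) h1)
    exact_mod_cast h2.trans h3
  refine le_trans ?_ (mul_le_mul_of_nonneg_right hT (pow_nonneg hp _))
  rw [← nsmul_eq_mul]
  refine sum_le_card_nsmul _ _ _ fun T hT => ?_
  rw [← (mem_filter.1 hT).2]
  exact prob_subset_le hp hp1 T

theorem prob_survives_le {V : Type*} [DecidableEq V] [Fintype V] {G : Finset (Finset V)}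
    {p : ℝ} (hp : 0 ≤ p) (hp1 : p ≤ 1 / 2) {d k : ℕ} (hG : ∀ s ∈ G, s.card = d + 1)
    {σ : Finset V} (hσ : σ.card = d + 1) (hN : treeSize d k + 1 ≤ Fintype.card V) :
    prob G p (fun S => Survives d S k σ) ≤ p * treeBound d (Fintype.card V) p k +
      ∑ j ∈ range (treeSize d k + 1),
        (Fintype.card V : ℝ) ^ j * (2 ^ 2 ^ (d + 1 + (treeSize d k + 1)) * p ^ (j + 2)) := by
  have hp' : p ≤ 1 := by linarith
  obtain ⟨τ, hτσ, hτ⟩ := exists_subset_card_eq (s := σ) (n := d) (by omega)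
  have h1 : prob G p (DisjOcc (fun S => σ ∈ S) (HasTree k τ)) ≤
      p * treeBound d (Fintype.card V) p k :=
    (prob_disjOcc_le hp hp1 (fun _ _ h hS => h hS) (HasTree.monotone k τ)).trans
      (mul_le_mul (prob_mem_le hp hp' σ) (prob_hasTree_le G hp hp1 k hτ) (prob_nonneg hp hp') hp)
  refine le_trans ?_ (add_le_add h1 (prob_not_locallyTreelike_le G hp hp' hσ hN))
  refine le_trans (prob_mono hp hp' fun S hS h => ?_) (prob_or_le hp hp')
  by_cases hg : LocallyTreelike d (treeSize d k + 1) σ S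
  · exact .inl (h.disjOcc (fun s hs => hG s (hS hs)) hg hτσ hτ)
  · exact .inr hg

/-! ### From complexes to families of simplices -/

/-- The finite set of `d`-simplices of a complex on the vertices `0, …, n - 1`. -/
noncomputable def simplexFinset {n : ℕ} (K : PreAbstractSimplicialComplex (Fin n)) (d : ℕ) :
    Finset (Finset (Fin n)) :=
  (Set.toFinite (simplices K d)).toFinset

theorem mem_simplexFinset {n d : ℕ} {K : PreAbstractSimplicialComplex (Fin n)}
    {s : Finset (Fin n)} : s ∈ simplexFinset K d ↔ s ∈ K.faces ∧ s.card = d + 1 := by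
  simp [simplexFinset, simplices]

theorem card_simplexFinset {n : ℕ} (K : PreAbstractSimplicialComplex (Fin n)) (d : ℕ) :
    (simplexFinset K d).card = numSimplices K d :=
  (Set.ncard_eq_toFinset_card _ _).symm

theorem simplexFinset_subset {n : ℕ} (K : PreAbstractSimplicialComplex (Fin n)) (d : ℕ) :
    simplexFinset K d ⊆ powersetCard (d + 1) univ :=
  fun _ hs => mem_powersetCard.2 ⟨subset_univ _, (mem_simplexFinset.1 hs).2⟩

/-- The lower skeleton is full, so only the `d`-simplices vary. -/
theorem simplexFinset_injective (n d : ℕ) :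
    Function.Injective fun Y : Complexes n d => simplexFinset Y.1 d := by
  have key : ∀ Y Z : Complexes n d, simplexFinset Y.1 d = simplexFinset Z.1 d →
      ∀ s ∈ Y.1.faces, s ∈ Z.1.faces := by
    intro Y Z h s hs
    rcases (Y.2.2 s hs).lt_or_eq with hc | hc
    · exact Z.2.1 s (Y.1.isRelLowerSet_faces hs).1 (by omega)
    · exact (mem_simplexFinset.1 (h ▸ mem_simplexFinset.2 ⟨hs, hc⟩)).1
  intro Y Z h
  refine Subtype.ext (PreAbstractSimplicialComplex.ext ?_)
  exact Set.Subset.antisymm (key Y Z h) (key Z Y h.symm)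

theorem randomComplex_le_ofReal_prob {d n : ℕ} {p : ℝ} (hp : 0 ≤ p) (hp1 : p ≤ 1)
    {E : Set (Complexes n d)} {A : Finset (Finset (Fin n)) → Prop}
    (h : ∀ Y ∈ E, A (simplexFinset Y.1 d)) :
    randomComplex d n p E ≤
      ENNReal.ofReal (prob (powersetCard (d + 1) (univ : Finset (Fin n))) p A) := by
  classical
  set G := powersetCard (d + 1) (univ : Finset (Fin n)) with hG
  have hGc : G.card = n.choose (d + 1) := by simp [hG]
  let g : Finset (Finset (Fin n)) → ENNReal := fun S => if S ∈ G.powerset then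
    ENNReal.ofReal (if A S then p ^ S.card * (1 - p) ^ (G.card - S.card) else 0) else 0
  rw [randomComplex, MeasureTheory.Measure.sum_apply _ (MeasurableSpace.measurableSet_top (s := E))]
  calc _ ≤ ∑' Y : Complexes n d, g (simplexFinset Y.1 d) := by
        refine ENNReal.tsum_le_tsum fun Y => ?_
        rw [MeasureTheory.Measure.smul_apply, MeasureTheory.Measure.dirac_apply' _ (MeasurableSpace.measurableSet_top (s := E))]
        by_cases hY : Y ∈ E
        · simp [g, hY, h Y hY, hG, simplexFinset_subset, card_simplexFinset]
        · simp [hY]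
    _ ≤ ∑' S, g S := ENNReal.tsum_comp_le_tsum_of_injective (simplexFinset_injective n d) g
    _ = ∑ S ∈ G.powerset, g S := tsum_eq_sum fun S hS => if_neg hS
    _ = _ := by
        rw [prob, ENNReal.ofReal_sum_of_nonneg]
        · refine sum_congr rfl fun S hS => ?_
          simp only [g, if_pos hS]
        · intro S _
          split_ifs
          exacts [weight_nonneg hp hp1 _ _, le_rfl]

/-- If no other simplex of `R_k(K)` contained the facet `τ`, then `τ` would be free and `s` would be
removed in the next step. -/
theorem survives_of_mem_collapseIter {n d : ℕ} {K : PreAbstractSimplicialComplex (Fin n)}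
    {k : ℕ} {s : Finset (Fin n)} (hs : s ∈ simplices (collapseIter d K k) d) :
    Survives d (simplexFinset K d) k s := by
  induction k generalizing s with
  | zero => exact mem_simplexFinset.2 hs
  | succ k ih =>
    have hk : s ∈ simplices (collapseIter d K k) d := ⟨hs.1.1, hs.2⟩
    refine ⟨ih hk, fun τ hτs hτ => ?_⟩
    by_contra! hcon
    refine hs.1.2 τ ⟨hτ, s, ⟨hk, hτs⟩, fun s' hs' => ?_⟩ hτs
    by_contra hne
    exact hcon s' hne (ih hs'.1) hs'.2

theorem numSimplices_core_le {n : ℕ} (d : ℕ) (K : PreAbstractSimplicialComplex (Fin n)) (k : ℕ)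
    [DecidablePred (Survives d (simplexFinset K d) k)] :
    numSimplices (core d K) d ≤
      ((powersetCard (d + 1) univ).filter (Survives d (simplexFinset K d) k)).card := by
  rw [← card_simplexFinset]
  refine card_le_card fun s hs => mem_filter.2 ⟨simplexFinset_subset _ _ hs, ?_⟩
  have := mem_simplexFinset.1 hs
  exact survives_of_mem_collapseIter ⟨this.1 k, this.2⟩

/-! ### The limit of the tree probabilities -/

open Filter Topology

/-- The probability that the branching process with Poisson offspring has a tree of depth `k`. -/
noncomputable def limitBound (d : ℕ) (c : ℝ) : ℕ → ℝ
  | 0 => 1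
  | k + 1 => 1 - Real.exp (-(c * limitBound d c k ^ d))

theorem tendsto_treeBound (d : ℕ) (c : ℝ) (k : ℕ) :
    Tendsto (fun n : ℕ => treeBound d n (c / n) k) atTop (𝓝 (limitBound d c k)) := by
  induction k with
  | zero => exact tendsto_const_nhds
  | succ k ih =>
    have h : Tendsto (fun n : ℕ => (n : ℝ) * -(c / n * treeBound d n (c / n) k ^ d)) atTop
        (𝓝 (-(c * limitBound d c k ^ d))) := by
      refine ((ih.pow d).const_mul c).neg.congr' ?_
      filter_upwards [eventually_ne_atTop 0] with n hn
      have : (n : ℝ) ≠ 0 := Nat.cast_ne_zero.2 hn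
      field_simp
    simpa only [treeBound, limitBound, sub_eq_add_neg] using
      (Real.tendsto_one_add_pow_exp_of_tendsto h).const_sub 1

theorem tendsto_limitBound {d : ℕ} {c : ℝ} (hc : 0 < c) (hcγ : c < gammaConst d) :
    Tendsto (limitBound d c) atTop (𝓝 0) := by
  have hnn : ∀ k, 0 ≤ limitBound d c k := by
    intro k
    induction k with
    | zero => simp [limitBound]
    | succ k ih =>
      have : Real.exp (-(c * limitBound d c k ^ d)) ≤ 1 :=
        Real.exp_le_one_iff.2 (neg_nonpos.2 (by positivity))
      simp only [limitBound]; linarith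
  have hanti : Antitone (limitBound d c) := by
    refine antitone_nat_of_succ_le fun k => ?_
    induction k with
    | zero => simp only [limitBound]; linarith [Real.exp_pos (-(c * 1 ^ d))]
    | succ k ih =>
      have h1 := pow_le_pow_left₀ (hnn (k + 1)) ih d
      have h2 := mul_le_mul_of_nonneg_left h1 hc.le
      exact sub_le_sub_left (Real.exp_le_exp.2 (neg_le_neg h2)) 1
  obtain ⟨L, hL⟩ : ∃ L, Tendsto (limitBound d c) atTop (𝓝 L) :=
    ⟨_, tendsto_atTop_ciInf hanti ⟨0, by rintro _ ⟨k, rfl⟩; exact hnn k⟩⟩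
  have hL0 : 0 ≤ L := ge_of_tendsto' hL hnn
  have hfix : L = 1 - Real.exp (-(c * L ^ d)) := by
    refine tendsto_nhds_unique ((tendsto_add_atTop_iff_nat 1).2 hL) ?_
    simp only [limitBound]
    exact (((hL.pow d).const_mul c).neg.rexp).const_sub 1
  rcases hL0.eq_or_lt with h | h
  · rwa [h]
  -- A positive limit `L` makes `x = 1 - L < 1` a solution of the equation at `γ = c`, so `γ_d ≤ c`.
  · refine absurd hcγ (not_lt.2 (csInf_le ⟨0, fun γ hγ => hγ.1⟩ ⟨hc.le, 1 - L, by linarith, ?_⟩))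
    rw [sub_sub_cancel, neg_mul]
    linarith

/-- Markov's inequality over at most `n ^ (d + 1)` simplices: the tree term contributes `c t n ^ d`,
the cycle term `K n ^ (d - 1)`, where `K` depends on `k` but not on `n`. -/
theorem exists_core_bound (d k : ℕ) {δ c : ℝ} (hδ : 0 < δ) (hc : 0 < c) :
    ∃ K : ℝ, ∀ᶠ n : ℕ in atTop, randomComplex d n (c / (n : ℝ))
        {Y : Complexes n d | δ * (n : ℝ) ^ d < (numSimplices (core d Y.1) d : ℝ)} ≤
      ENNReal.ofReal ((c * treeBound d n (c / n) k + K * (n : ℝ)⁻¹) / δ) := by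
  classical
  set M := treeSize d k + 1 with hM
  refine ⟨∑ j ∈ range M, 2 ^ 2 ^ (d + 1 + M) * c ^ (j + 2), ?_⟩
  filter_upwards [eventually_ge_atTop M, eventually_ge_atTop 1,
    (tendsto_natCast_atTop_atTop (R := ℝ)).eventually_ge_atTop (2 * c)] with n hn hn1 hn2
  have hn0 : (0 : ℝ) < n := by exact_mod_cast hn1
  have hp : 0 ≤ c / n := by positivity
  have hp1 : c / n ≤ 1 / 2 := by rw [div_le_div_iff₀ hn0 two_pos]; linarith
  have hp' : c / n ≤ 1 := by linarith
  set G := powersetCard (d + 1) (univ : Finset (Fin n)) with hG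
  refine (randomComplex_le_ofReal_prob (A := fun S =>
    δ * (n : ℝ) ^ d < ((G.filter fun s => Survives d S k s).card : ℝ)) hp hp' ?_).trans ?_
  · intro Y hY
    exact lt_of_lt_of_le hY (by exact_mod_cast numSimplices_core_le d Y.1 k)
  refine ENNReal.ofReal_le_ofReal ?_
  have h1 := mul_prob_le_sum (G := G) hp hp' G (fun s S => Survives d S k s) (δ * (n : ℝ) ^ d)
  have hGm : ∀ s ∈ G, s.card = d + 1 := fun s hs => (mem_powersetCard.1 hs).2
  have h2 := sum_le_card_nsmul G _ _ fun s hs =>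
    prob_survives_le (k := k) hp hp1 hGm (hGm s hs) (by rwa [Fintype.card_fin])
  simp only [Fintype.card_fin, nsmul_eq_mul, ← hM] at h2
  set t := treeBound d n (c / n) k with ht
  have ht0 : 0 ≤ t := (treeBound_mem_Icc d n hp hp' k).1
  have hsum : ∑ j ∈ range M, (n : ℝ) ^ j * (2 ^ 2 ^ (d + 1 + M) * (c / n) ^ (j + 2)) =
      (∑ j ∈ range M, 2 ^ 2 ^ (d + 1 + M) * c ^ (j + 2)) * ((n : ℝ) ^ 2)⁻¹ := by
    rw [sum_mul]
    refine sum_congr rfl fun j _ => ?_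
    rw [div_pow, pow_add (n : ℝ)]
    field_simp
  rw [hsum] at h2
  set K := ∑ j ∈ range M, (2 : ℝ) ^ 2 ^ (d + 1 + M) * c ^ (j + 2) with hK
  have hK0 : 0 ≤ K := sum_nonneg fun j _ => by positivity
  have hGc : (G.card : ℝ) ≤ (n : ℝ) ^ (d + 1) := by
    rw [hG, card_powersetCard, card_univ, Fintype.card_fin]
    exact_mod_cast Nat.choose_le_pow _ _
  have h3 := (h1.trans h2).trans (mul_le_mul_of_nonneg_right hGc (by positivity))
  have h4 : (n : ℝ) ^ (d + 1) * (c / n * t + K * ((n : ℝ) ^ 2)⁻¹) =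
      (n : ℝ) ^ d * (c * t + K * (n : ℝ)⁻¹) := by
    rw [pow_succ]; field_simp
  rw [h4, mul_right_comm, mul_comm _ ((n : ℝ) ^ d)] at h3
  rw [le_div_iff₀' hδ]
  exact le_of_mul_le_mul_left h3 (by positivity)

end RandomComplex

theorem theorem5 (d : ℕ) (hd : 2 ≤ d) (δ c : ℝ) (hδ : 0 < δ) (hc : 0 < c)
    (hcγ : c < RandomComplex.gammaConst d) :
    Filter.Tendsto
      (fun n : ℕ => RandomComplex.randomComplex d n (c / (n : ℝ))
        {Y : RandomComplex.Complexes n d |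
          δ * (n : ℝ) ^ d < (RandomComplex.numSimplices (RandomComplex.core d Y.1) d : ℝ)})
      Filter.atTop (nhds 0) := by
  rw [ENNReal.tendsto_nhds_zero]
  intro ε hε
  obtain ⟨r, -, hr, hrε⟩ := ENNReal.lt_iff_exists_real_btwn.1 hε
  have hr0 : 0 < r := ENNReal.ofReal_pos.1 hr
  -- The depth `k` is fixed before `n` tends to infinity, since the cycle constant depends on it.
  have hk : ∀ᶠ k in Filter.atTop, c * RandomComplex.limitBound d c k / δ < r := by
    refine Filter.Tendsto.eventually_lt_const hr0 ?_
    simpa using ((RandomComplex.tendsto_limitBound hc hcγ).const_mul c).div_const δ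
  obtain ⟨k, hk⟩ := hk.exists
  obtain ⟨K, hK⟩ := RandomComplex.exists_core_bound d k hδ hc
  have hlim : Filter.Tendsto (fun n : ℕ =>
      (c * RandomComplex.treeBound d n (c / n) k + K * (n : ℝ)⁻¹) / δ) Filter.atTop
      (nhds ((c * RandomComplex.limitBound d c k + K * 0) / δ)) :=
    (((RandomComplex.tendsto_treeBound d c k).const_mul c).add
      (tendsto_inv_atTop_nhds_zero_nat.const_mul K)).div_const δ
  rw [mul_zero, add_zero] at hlim
  filter_upwards [hK, hlim.eventually_lt_const hk] with n h1 h2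
  exact h1.trans ((ENNReal.ofReal_le_ofReal h2.le).trans hrε.le)
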